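/- Let $n \ge 1$, let $\mathcal K^n$ be the set of convex bodies (non-empty compact convex sets) in $\mathbb R^n$, and let $C \in \mathcal K^n$ have non-empty interior. For a non-empty compact set $K\subset\mathbb R^n$ let the circumradius $R(K,C)$ be the smallest $\lambda \ge 0$ such that a translate of $K$ is contained in $\lambda C$, let the inradius $r(K,C)$ be the largest $\lambda \ge 0$ such that a translate of $K$ contains $\lambda C$, and let the diameter be $D(K,C) = 2\max_{x,y\in K} R(\{x,y\},C)$. Put $$f(\mathcal K^n,C) = \left\{ \left( \frac{r(K,C)}{R(K,C)}, \frac{D(K,C)}{2R(K,C)} \right) : K \in \mathcal K^n,\ K \text{ has at least two points} \right\} \subset \mathbb R^2 .$$ A parallelotope is a set of the form $p + \{\sum_{i=1}^n s_i v_i : 0 \le s_i \le 1\}$ with $p \in \mathbb R^n$ and $v_1,\dots,v_n \in \mathbb R^n$ linearly independent. 1. If $n \ge 2$, then $\operatorname{conv}\{(0,1),(1,1)\} \subset f(\mathcal K^n,C)$, and equality holds if and only if $C$ is a parallelotope. 2. $C$ is a parallelotope if and only if $D(K,C) = 2R(K,C)$ for every $K \in \mathcal K^n$. -/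

import Mathlib

open scoped Pointwise

noncomputable section

/-- The circumradius `R(K, C)`: the smallest `μ ≥ 0` such that a translate of `K` is contained
in `μ C`. -/
def circumradius {E : Type*} [AddCommGroup E] [Module ℝ E] (K C : Set E) : ℝ :=
  sInf {μ : ℝ | 0 ≤ μ ∧ ∃ t : E, t +ᵥ K ⊆ μ • C}

/-- The inradius `r(K, C)`: the largest `μ ≥ 0` such that a translate of `K` contains `μ C`. -/
def inradius {E : Type*} [AddCommGroup E] [Module ℝ E] (K C : Set E) : ℝ :=
  sSup {μ : ℝ | 0 ≤ μ ∧ ∃ t : E, μ • C ⊆ t +ᵥ K}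

/-- The diameter `D(K, C)`: twice the maximal circumradius `R({x, y}, C)` with `x, y ∈ K`. -/
def gaugeDiameter {E : Type*} [AddCommGroup E] [Module ℝ E] (K C : Set E) : ℝ :=
  2 * sSup {ρ : ℝ | ∃ x ∈ K, ∃ y ∈ K, ρ = circumradius {x, y} C}

/-- The point `f(K, C) = (r(K, C) / R(K, C), D(K, C) / (2 R(K, C)))`. -/
def diagramPoint {E : Type*} [AddCommGroup E] [Module ℝ E] (K C : Set E) : ℝ × ℝ :=
  (inradius K C / circumradius K C, gaugeDiameter K C / (2 * circumradius K C))

/-- The `(r, D, R)`-diagram `f(𝒦ⁿ, C)`. A one-point body `K` has `R(K, C) = 0`, so that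
`f(K, C)` is undefined; hence `K` runs over the convex bodies with at least two points. -/
def diagram {n : ℕ} (C : ConvexBody (EuclideanSpace ℝ (Fin n))) : Set (ℝ × ℝ) :=
  {p | ∃ K : ConvexBody (EuclideanSpace ℝ (Fin n)),
    (K : Set (EuclideanSpace ℝ (Fin n))).Nontrivial ∧
      p = diagramPoint (K : Set (EuclideanSpace ℝ (Fin n))) C}

/-- An (`n`-dimensional) parallelotope in `ℝⁿ`: a translate of
`{∑ i, s i • v i : 0 ≤ s i ≤ 1}` with `v` linearly independent. -/
def IsParallelotope {n : ℕ} (C : Set (EuclideanSpace ℝ (Fin n))) : Prop :=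
  ∃ (p : EuclideanSpace ℝ (Fin n)) (v : Fin n → EuclideanSpace ℝ (Fin n)),
    LinearIndependent ℝ v ∧ C = p +ᵥ parallelepiped v

end

open Set

theorem vadd_set_subset_iff_forall {E : Type*} [AddCommGroup E] {t : E} {K A : Set E} :
    t +ᵥ K ⊆ A ↔ ∀ k ∈ K, t + k ∈ A := by
  simp [Set.subset_def, Set.mem_vadd_set]

section AddCommGroup

variable {E : Type*} [AddCommGroup E] [Module ℝ E]

theorem exists_vadd_subset_smul_vadd_iff {K C : Set E} (c : E) (μ : ℝ) :
    (∃ t : E, t +ᵥ K ⊆ μ • (c +ᵥ C)) ↔ ∃ t : E, t +ᵥ K ⊆ μ • C := by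
  simp only [vadd_set_subset_iff_forall, mem_smul_set, mem_vadd_set]
  constructor
  · rintro ⟨t, ht⟩
    refine ⟨t - μ • c, fun k hk => ?_⟩
    obtain ⟨_, ⟨x, hx, rfl⟩, h⟩ := ht k hk
    refine ⟨x, hx, ?_⟩
    rw [vadd_eq_add, smul_add] at h
    rw [sub_add_eq_add_sub, ← h, add_sub_cancel_left]
  · rintro ⟨t, ht⟩
    refine ⟨t + μ • c, fun k hk => ?_⟩
    obtain ⟨x, hx, h⟩ := ht k hk
    refine ⟨c + x, ⟨x, hx, rfl⟩, ?_⟩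
    rw [smul_add, h]
    abel

/-- The circumradius does not change when the gauge body is translated. -/
theorem circumradius_vadd_right (K C : Set E) (c : E) :
    circumradius K (c +ᵥ C) = circumradius K C := by
  simp only [circumradius, exists_vadd_subset_smul_vadd_iff]

theorem gaugeDiameter_vadd_right (K C : Set E) (c : E) :
    gaugeDiameter K (c +ᵥ C) = gaugeDiameter K C := by
  simp only [gaugeDiameter, circumradius_vadd_right]

theorem circumradius_nonneg (K C : Set E) : 0 ≤ circumradius K C :=
  Real.sInf_nonneg fun _ h => h.1

theorem circumradius_le {K C : Set E} {μ : ℝ} (hμ : 0 ≤ μ) {t : E}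
    (h : ∀ k ∈ K, t + k ∈ μ • C) : circumradius K C ≤ μ :=
  csInf_le ⟨0, fun _ h => h.1⟩ ⟨hμ, t, vadd_set_subset_iff_forall.2 h⟩

end AddCommGroup

theorem exists_zero_mem_interior_vadd {E : Type*} [NormedAddCommGroup E] {C : Set E} (hC : (interior C).Nonempty) :
    ∃ c : E, (0 : E) ∈ interior (c +ᵥ C) := by
  obtain ⟨x, hx⟩ := hC
  refine ⟨-x, ?_⟩
  rw [interior_vadd]
  exact ⟨x, hx, by simp⟩

section Normed

variable {E : Type*} [NormedAddCommGroup E] [NormedSpace ℝ E]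

/-- For a convex body containing the origin in its interior, dilates are gauge sublevel sets. -/
theorem mem_smul_iff_gauge_le {C : Set E} (hc : IsCompact C) (hconv : Convex ℝ C)
    (h0 : (0 : E) ∈ interior C) {μ : ℝ} (hμ : 0 ≤ μ) {x : E} :
    x ∈ μ • C ↔ gauge C x ≤ μ := by
  have hnhds : C ∈ nhds (0 : E) := mem_interior_iff_mem_nhds.1 h0
  refine ⟨gauge_le_of_mem hμ, fun h => ?_⟩
  rcases hμ.eq_or_lt with rfl | hpos
  · have hx : x = 0 :=
      (gauge_eq_zero (absorbent_nhds_zero hnhds) (hc.isVonNBounded ℝ)).1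
        (le_antisymm h (gauge_nonneg x))
    exact ⟨0, interior_subset h0, by simp [hx]⟩
  · rw [mem_smul_set_iff_inv_smul_mem₀ hpos.ne', ← hc.isClosed.closure_eq,
      ← gauge_le_one_iff_mem_closure hconv hnhds, gauge_smul_of_nonneg (inv_nonneg.2 hμ),
      smul_eq_mul, inv_mul_le_iff₀ hpos, mul_one]
    exact h

theorem exists_vadd_subset_circumradius_of_zero_mem {K C : Set E} (hK : IsCompact K)
    (hK' : K.Nonempty) (hc : IsCompact C) (hconv : Convex ℝ C) (h0 : (0 : E) ∈ interior C) :
    ∃ t : E, t +ᵥ K ⊆ circumradius K C • C := by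
  have hnhds : C ∈ nhds (0 : E) := mem_interior_iff_mem_nhds.1 h0
  have hg : Continuous (gauge C) := continuous_gauge hconv hnhds
  obtain ⟨k₀, hk₀⟩ := hK'
  obtain ⟨k₁, hk₁, hmax⟩ := hK.exists_isMaxOn ⟨k₀, hk₀⟩ hg.continuousOn
  set M := gauge C k₁ with hM
  have hM0 : 0 ≤ M := gauge_nonneg _
  let T : Set (ℝ × E) := (Icc 0 M ×ˢ ((-k₀) +ᵥ (M • C))) ∩
    {q | ∀ k ∈ K, gauge C (q.2 + k) ≤ q.1}
  have hT : IsCompact T := by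
    refine (isCompact_Icc.prod ((hc.smul M).vadd _)).inter_right ?_
    simp only [ofPred_forall]
    refine isClosed_biInter fun k _ => isClosed_le ?_ continuous_fst
    exact hg.comp (continuous_snd.add continuous_const)
  have hmem : ∀ (μ : ℝ) (t : E), 0 ≤ μ → μ ≤ M → (∀ k ∈ K, t + k ∈ μ • C) → (μ, t) ∈ T := by
    intro μ t hμ hμM h
    have h' : ∀ k ∈ K, gauge C (t + k) ≤ μ := fun k hk => gauge_le_of_mem hμ (h k hk)
    refine ⟨⟨⟨hμ, hμM⟩, ⟨t + k₀, ?_, by simp⟩⟩, h'⟩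
    exact (mem_smul_iff_gauge_le hc hconv h0 hM0).2 ((h' k₀ hk₀).trans hμM)
  have hMT : (M, (0 : E)) ∈ T := hmem M 0 hM0 le_rfl fun k hk => by
    rw [zero_add]
    exact (mem_smul_iff_gauge_le hc hconv h0 hM0).2 (hmax hk)
  obtain ⟨⟨μ, t⟩, hμt, hmin⟩ := hT.exists_isMinOn ⟨_, hMT⟩ continuous_fst.continuousOn
  have hμ0 : 0 ≤ μ := hμt.1.1.1
  have hin : t +ᵥ K ⊆ μ • C := vadd_set_subset_iff_forall.2 fun k hk =>
    (mem_smul_iff_gauge_le hc hconv h0 hμ0).2 (hμt.2 k hk)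
  have hleast : IsLeast {μ : ℝ | 0 ≤ μ ∧ ∃ t : E, t +ᵥ K ⊆ μ • C} μ := by
    refine ⟨⟨hμ0, t, hin⟩, ?_⟩
    rintro ν ⟨hν, s, hs⟩
    rcases le_total ν M with h | h
    · exact hmin (hmem ν s hν h (vadd_set_subset_iff_forall.1 hs))
    · exact hμt.1.1.2.trans h
  refine ⟨t, ?_⟩
  rw [circumradius, hleast.csInf_eq]
  exact hin

/-- The infimum defining the circumradius is attained. -/
theorem exists_forall_add_mem_circumradius_smul {K C : Set E} (hK : IsCompact K)
    (hK' : K.Nonempty) (hc : IsCompact C) (hconv : Convex ℝ C) (hint : (interior C).Nonempty) :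
    ∃ t : E, ∀ k ∈ K, t + k ∈ circumradius K C • C := by
  obtain ⟨c, h0⟩ := exists_zero_mem_interior_vadd hint
  have := exists_vadd_subset_circumradius_of_zero_mem hK hK' (hc.vadd c) (hconv.vadd c) h0
  rw [exists_vadd_subset_smul_vadd_iff, circumradius_vadd_right] at this
  simpa only [vadd_set_subset_iff_forall] using this

theorem circumradius_mono {K L C : Set E} (hKL : K ⊆ L) (hL : IsCompact L)
    (hL' : L.Nonempty) (hc : IsCompact C) (hconv : Convex ℝ C) (hint : (interior C).Nonempty) :
    circumradius K C ≤ circumradius L C := by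
  obtain ⟨t, ht⟩ := exists_forall_add_mem_circumradius_smul hL hL' hc hconv hint
  exact circumradius_le (circumradius_nonneg _ _) fun k hk => ht k (hKL hk)

theorem circumradius_pos {K C : Set E} (hK : IsCompact K) (hK' : K.Nontrivial)
    (hc : IsCompact C) (hconv : Convex ℝ C) (hint : (interior C).Nonempty) :
    0 < circumradius K C := by
  refine (circumradius_nonneg K C).lt_of_ne fun h => ?_
  obtain ⟨t, ht⟩ := exists_forall_add_mem_circumradius_smul hK hK'.nonempty hc hconv hint
  rw [← h] at ht
  obtain ⟨x, hx, y, hy, hxy⟩ := hK'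
  have hz : ∀ k ∈ K, t + k = 0 := fun k hk => by
    obtain ⟨z, -, hz⟩ := ht k hk
    simpa using hz.symm
  exact hxy (add_left_cancel ((hz x hx).trans (hz y hy).symm))

theorem bddAbove_circumradius_pair {K C : Set E} (hK : IsCompact K) (hK' : K.Nonempty)
    (hc : IsCompact C) (hconv : Convex ℝ C) (hint : (interior C).Nonempty) :
    circumradius K C ∈ upperBounds {ρ : ℝ | ∃ x ∈ K, ∃ y ∈ K, ρ = circumradius {x, y} C} := by
  rintro _ ⟨x, hx, y, hy, rfl⟩
  exact circumradius_mono (pair_subset hx hy) hK hK' hc hconv hint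

theorem circumradius_pair_le {K C : Set E} (hK : IsCompact K)
    (hc : IsCompact C) (hconv : Convex ℝ C) (hint : (interior C).Nonempty)
    {x y : E} (hx : x ∈ K) (hy : y ∈ K) :
    circumradius {x, y} C ≤ gaugeDiameter K C / 2 := by
  rw [gaugeDiameter, mul_div_cancel_left₀ _ two_ne_zero]
  exact le_csSup ⟨_, bddAbove_circumradius_pair hK ⟨x, hx⟩ hc hconv hint⟩ ⟨x, hx, y, hy, rfl⟩

theorem gaugeDiameter_le {K C : Set E} (hK' : K.Nonempty) {d : ℝ}
    (h : ∀ x ∈ K, ∀ y ∈ K, circumradius {x, y} C ≤ d) : gaugeDiameter K C ≤ 2 * d := by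
  obtain ⟨x, hx⟩ := hK'
  refine mul_le_mul_of_nonneg_left (csSup_le ⟨_, x, hx, x, hx, rfl⟩ ?_) zero_le_two
  rintro _ ⟨x, hx, y, hy, rfl⟩
  exact h x hx y hy

theorem gaugeDiameter_le_two_mul_circumradius {K C : Set E} (hK : IsCompact K)
    (hK' : K.Nonempty) (hc : IsCompact C) (hconv : Convex ℝ C) (hint : (interior C).Nonempty) :
    gaugeDiameter K C ≤ 2 * circumradius K C :=
  gaugeDiameter_le hK' fun _ hx _ hy =>
    circumradius_mono (pair_subset hx hy) hK hK' hc hconv hint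

end Normed

section Width

variable {E : Type*} [NormedAddCommGroup E] [NormedSpace ℝ E]

theorem exists_apply_lt_apply_of_interior_nonempty {C : Set E} (hint : (interior C).Nonempty)
    {f : StrongDual ℝ E} (hf : f ≠ 0) : ∃ x ∈ C, ∃ y ∈ C, f y < f x := by
  obtain ⟨v, hv⟩ : ∃ v, 0 < f v := by
    obtain ⟨v, hv⟩ := DFunLike.ne_iff.1 hf
    rcases lt_or_gt_of_ne hv with h | h
    · exact ⟨-v, by simpa using h⟩
    · exact ⟨v, by simpa using h⟩
  obtain ⟨x, hx⟩ := hint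
  have hcont : Continuous fun ε : ℝ => x + ε • v := by fun_prop
  have hev : ∀ᶠ ε : ℝ in nhds 0, x + ε • v ∈ interior C :=
    hcont.continuousAt.eventually_mem (isOpen_interior.mem_nhds (by simpa using hx))
  obtain ⟨ε, hε, hpos⟩ :=
    ((hev.filter_mono nhdsWithin_le_nhds).and (self_mem_nhdsWithin (s := Ioi (0 : ℝ)))).exists
  refine ⟨_, interior_subset hε, x, interior_subset hx, ?_⟩
  have : 0 < ε * f v := mul_pos hpos hv
  simpa using this

theorem mul_apply_sub_apply_le {K C : Set E} {f : StrongDual ℝ E} {μ w : ℝ} {t : E}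
    (h : μ • C ⊆ t +ᵥ K) (hw : ∀ x ∈ K, ∀ y ∈ K, f x - f y ≤ w) {x y : E}
    (hx : x ∈ C) (hy : y ∈ C) : μ * (f x - f y) ≤ w := by
  obtain ⟨x', hx', hxx⟩ := h (smul_mem_smul_set hx)
  obtain ⟨y', hy', hyy⟩ := h (smul_mem_smul_set hy)
  have h1 := congrArg f hxx
  have h2 := congrArg f hyy
  simp only [vadd_eq_add, map_add, map_smul, smul_eq_mul] at h1 h2
  have := hw x' hx' y' hy'
  linarith

/-- A nonzero functional has a positive width on a body with interior points, and it is attained. -/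
theorem exists_max_width {C : Set E} (hc : IsCompact C) (hint : (interior C).Nonempty)
    {f : StrongDual ℝ E} (hf : f ≠ 0) :
    ∃ x ∈ C, ∃ y ∈ C, 0 < f x - f y ∧ ∀ x' ∈ C, ∀ y' ∈ C, f x' - f y' ≤ f x - f y := by
  obtain ⟨a, ha, b, hb, hab⟩ := exists_apply_lt_apply_of_interior_nonempty hint hf
  obtain ⟨x, hx, hmax⟩ := hc.exists_isMaxOn ⟨a, ha⟩ f.continuous.continuousOn
  obtain ⟨y, hy, hmin⟩ := hc.exists_isMinOn ⟨a, ha⟩ f.continuous.continuousOn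
  have hM : ∀ z ∈ C, f z ≤ f x := fun z hz => hmax hz
  have hm : ∀ z ∈ C, f y ≤ f z := fun z hz => hmin hz
  refine ⟨x, hx, y, hy, ?_, fun x' hx' y' hy' => ?_⟩
  · linarith [hM a ha, hm b hb]
  · linarith [hM x' hx', hm y' hy']

theorem zero_mem_inradius_set {K C : Set E} (hK : K.Nonempty) :
    (0 : ℝ) ∈ {μ : ℝ | 0 ≤ μ ∧ ∃ t : E, μ • C ⊆ t +ᵥ K} := by
  obtain ⟨k, hk⟩ := hK
  refine ⟨le_rfl, -k, ?_⟩
  rintro _ ⟨x, -, rfl⟩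
  exact ⟨k, hk, by simp⟩

theorem inradius_nonneg (K C : Set E) : 0 ≤ inradius K C :=
  Real.sSup_nonneg fun _ h => h.1

theorem inradius_le_circumradius [FiniteDimensional ℝ E] [Nontrivial E] {K C : Set E}
    (hK : IsCompact K) (hK' : K.Nonempty)
    (hc : IsCompact C) (hconv : Convex ℝ C) (hint : (interior C).Nonempty) :
    inradius K C ≤ circumradius K C := by
  obtain ⟨f, hf⟩ := exists_ne (0 : StrongDual ℝ E)
  obtain ⟨x, hx, y, hy, hpos, hmax⟩ := exists_max_width hc hint hf
  refine csSup_le ⟨0, zero_mem_inradius_set hK'⟩ ?_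
  rintro μ ⟨-, t, ht⟩
  obtain ⟨s, hs⟩ := exists_forall_add_mem_circumradius_smul hK hK' hc hconv hint
  have := mul_apply_sub_apply_le (f := f) (w := circumradius K C * (f x - f y)) ht ?_ hx hy
  · exact le_of_mul_le_mul_right this hpos
  · intro x' hx' y' hy'
    obtain ⟨a, ha, hax⟩ := hs x' hx'
    obtain ⟨b, hb, hby⟩ := hs y' hy'
    have h1 := congrArg f hax
    have h2 := congrArg f hby
    simp only [map_add, map_smul, smul_eq_mul] at h1 h2
    have := mul_le_mul_of_nonneg_left (hmax a ha b hb) (circumradius_nonneg K C)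
    linarith

/-- Every convex body contains a pair of points with the circumradius of the body itself. -/
theorem exists_circumradius_pair_eq_one [Nontrivial E] {C : Set E} (hc : IsCompact C)
    (hconv : Convex ℝ C) (hint : (interior C).Nonempty) :
    ∃ x ∈ C, ∃ y ∈ C, circumradius {x, y} C = 1 := by
  obtain ⟨v, hv⟩ := exists_ne (0 : E)
  have hcomp : ∀ a b : E, IsCompact ({a, b} : Set E) := fun a b => (toFinite _).isCompact
  have hpos : 0 < circumradius {0, v} C :=
    circumradius_pos (hcomp _ _) ⟨0, by simp, v, by simp, hv.symm⟩ hc hconv hint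
  obtain ⟨t, ht⟩ := exists_forall_add_mem_circumradius_smul (hcomp 0 v) (by simp) hc hconv hint
  set R := circumradius {0, v} C with hR
  obtain ⟨x, hx, hxt⟩ := ht 0 (by simp)
  obtain ⟨y, hy, hyt⟩ := ht v (by simp)
  simp only [add_zero] at hxt hyt
  refine ⟨x, hx, y, hy, le_antisymm ?_ ?_⟩
  · refine circumradius_le zero_le_one (t := 0) ?_
    simp [hx, hy]
  · obtain ⟨s, hs⟩ :=
      exists_forall_add_mem_circumradius_smul (hcomp x y) (by simp) hc hconv hint
    set ρ := circumradius {x, y} C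
    have hρ : 0 ≤ ρ := circumradius_nonneg _ _
    have hle : R ≤ R * ρ := by
      refine circumradius_le (mul_nonneg hpos.le hρ) (t := t + R • s) ?_
      rintro k (rfl | rfl)
      · rw [mul_smul, add_zero, ← hxt, ← smul_add, add_comm]
        exact smul_mem_smul_set (hs x (by simp))
      · have : t + R • s + k = R • (s + y) := by rw [smul_add, hyt]; abel
        rw [this, mul_smul]
        exact smul_mem_smul_set (hs y (by simp))
    exact le_of_mul_le_mul_left (by simpa using hle) hpos

/-- In dimension at least two, all inradii in `[0, 1]` occur among bodies with
circumradius one and diameter two. -/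
theorem exists_inradius_eq [FiniteDimensional ℝ E] (hdim : 2 ≤ Module.finrank ℝ E) {C : Set E}
    (hc : IsCompact C) (hconv : Convex ℝ C) (hint : (interior C).Nonempty) {r : ℝ}
    (hr : r ∈ Icc (0 : ℝ) 1) :
    ∃ K : Set E, IsCompact K ∧ Convex ℝ K ∧ K.Nontrivial ∧ inradius K C = r ∧
      circumradius K C = 1 ∧ gaugeDiameter K C = 2 := by
  have : Nontrivial E := Module.nontrivial_of_finrank_pos (R := ℝ) (by lia)
  obtain ⟨x, hx, y, hy, hxy⟩ := exists_circumradius_pair_eq_one hc hconv hint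
  have hxy' : x ≠ y := by
    rintro rfl
    have : circumradius {x, x} C ≤ 0 := by
      refine circumradius_le le_rfl (t := -x) fun k hk => ⟨x, hx, ?_⟩
      obtain rfl : k = x := by simpa using hk
      simp
    linarith
  have hr' : 0 ≤ 1 - r := sub_nonneg.2 hr.2
  let K : Set E := r • C + (1 - r) • segment ℝ x y
  have hseg : segment ℝ x y ⊆ C := hconv.segment_subset hx hy
  have hmem : ∀ c ∈ C, ∀ s ∈ segment ℝ x y, r • c + (1 - r) • s ∈ K := fun c hc s hs =>
    add_mem_add (smul_mem_smul_set hc) (smul_mem_smul_set hs)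
  have hxK : x ∈ K := by
    have := hmem x hx x (left_mem_segment ℝ x y)
    rwa [← add_smul, add_sub_cancel, one_smul] at this
  have hyK : y ∈ K := by
    have := hmem y hy y (right_mem_segment ℝ x y)
    rwa [← add_smul, add_sub_cancel, one_smul] at this
  have hsegc : IsCompact (segment ℝ x y) := by
    rw [← convexHull_pair]
    exact (toFinite _).isCompact_convexHull ℝ
  have hKc : IsCompact K := (hc.smul r).add (hsegc.smul _)
  have hKconv : Convex ℝ K := (hconv.smul r).add ((convex_segment x y).smul _)
  have hKC : K ⊆ C := by
    rintro _ ⟨_, ⟨c, hc, rfl⟩, _, ⟨s, hs, rfl⟩, rfl⟩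
    exact hconv hc (hseg hs) hr.1 hr' (add_sub_cancel _ _)
  have hR : circumradius K C = 1 := by
    refine le_antisymm (circumradius_le zero_le_one (t := 0) fun k hk => ?_) ?_
    · simpa using hKC hk
    · rw [← hxy]
      exact circumradius_mono (pair_subset hxK hyK) hKc ⟨x, hxK⟩ hc hconv hint
  refine ⟨K, hKc, hKconv, ⟨x, hxK, y, hyK, hxy'⟩, ?_, hR, le_antisymm ?_ ?_⟩
  · have hlt : Submodule.span ℝ {x - y} < ⊤ := by
      refine lt_top_iff_ne_top.2 fun h => ?_
      have h1 := finrank_span_singleton (K := ℝ) (sub_ne_zero.2 hxy')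
      rw [h, finrank_top] at h1
      lia
    obtain ⟨f₀, hf₀, hker⟩ := Submodule.exists_le_ker_of_lt_top _ hlt
    let f : StrongDual ℝ E := LinearMap.toContinuousLinearMap f₀
    have hf : f ≠ 0 := by simpa [f] using hf₀
    have hfxy : f y - f x = 0 := by
      have : f₀ (x - y) = 0 := hker (Submodule.mem_span_singleton_self _)
      rw [map_sub] at this
      change f₀ y - f₀ x = 0
      linarith
    have hconst : ∀ s ∈ segment ℝ x y, f s = f x := by
      rintro _ ⟨a, b, -, -, hab, rfl⟩
      simp only [map_add, map_smul, smul_eq_mul]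
      linear_combination b * hfxy + f x * hab
    obtain ⟨a, ha, b, hb, hpos, hmax⟩ := exists_max_width hc hint hf
    refine IsGreatest.csSup_eq ⟨⟨hr.1, -((1 - r) • x), ?_⟩, ?_⟩
    · rintro _ ⟨c, hc, rfl⟩
      exact ⟨_, hmem c hc x (left_mem_segment ℝ x y), by simp⟩
    · rintro μ ⟨-, t, ht⟩
      have := mul_apply_sub_apply_le (f := f) (w := r * (f a - f b)) ht ?_ ha hb
      · exact le_of_mul_le_mul_right this hpos
      · rintro _ ⟨_, ⟨c, hc, rfl⟩, _, ⟨s, hs, rfl⟩, rfl⟩ _ ⟨_, ⟨c', hc', rfl⟩, _, ⟨s', hs', rfl⟩, rfl⟩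
        have := mul_le_mul_of_nonneg_left (hmax c hc c' hc') hr.1
        simp only [map_add, map_smul, smul_eq_mul, hconst s hs, hconst s' hs']
        linarith
  · simpa [hR] using gaugeDiameter_le_two_mul_circumradius hKc ⟨x, hxK⟩ hc hconv hint
  · have := circumradius_pair_le hKc hc hconv hint hxK hyK
    linarith

end Width

/-- For a parallelotope, the diameter of every convex body is twice its circumradius. -/
theorem IsParallelotope.gaugeDiameter_eq {n : ℕ} {C : Set (EuclideanSpace ℝ (Fin n))}
    (h : IsParallelotope C) (hc : IsCompact C) (hconv : Convex ℝ C)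
    (hint : (interior C).Nonempty) {K : Set (EuclideanSpace ℝ (Fin n))} (hK : IsCompact K)
    (hK' : K.Nonempty) : gaugeDiameter K C = 2 * circumradius K C := by
  refine le_antisymm (gaugeDiameter_le_two_mul_circumradius hK hK' hc hconv hint) ?_
  obtain ⟨p, v, hv, hCv⟩ := h
  let b := basisOfLinearIndependentOfCardEqFinrank' v hv (by simp)
  have hb : ⇑b = v := by simp [b]
  rw [← hb, parallelepiped_basis_eq] at hCv
  set d := gaugeDiameter K C / 2 with hd
  have hd0 : 0 ≤ d := by
    obtain ⟨x, hx⟩ := hK'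
    exact (circumradius_nonneg {x, x} C).trans (circumradius_pair_le hK hc hconv hint hx hx)
  have hcoord : ∀ i, ∀ x ∈ K, ∀ y ∈ K, b.repr x i - b.repr y i ≤ d := by
    intro i x hx y hy
    refine le_trans ?_ (circumradius_pair_le hK hc hconv hint hx hy)
    obtain ⟨t, ht⟩ := exists_forall_add_mem_circumradius_smul
      (toFinite ({x, y} : Set (EuclideanSpace ℝ (Fin n)))).isCompact (by simp) hc hconv hint
    obtain ⟨x', hx', hxx⟩ := ht x (by simp)
    obtain ⟨y', hy', hyy⟩ := ht y (by simp)
    rw [hCv] at hx' hy'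
    obtain ⟨x'', hx'', rfl⟩ := hx'
    obtain ⟨y'', hy'', rfl⟩ := hy'
    have h1 := congrArg (fun z => b.repr z i) hxx
    have h2 := congrArg (fun z => b.repr z i) hyy
    simp only [vadd_eq_add, map_add, map_smul, smul_eq_mul, Finsupp.add_apply,
      Finsupp.smul_apply] at h1 h2
    have hR := circumradius_nonneg {x, y} C
    have := mul_le_mul_of_nonneg_left (hx'' i).2 hR
    have := mul_nonneg hR (hy'' i).1
    linarith
  have hmin : ∀ i, ∃ k ∈ K, ∀ x ∈ K, b.repr k i ≤ b.repr x i := fun i => by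
    have hcont : Continuous fun x => b.repr x i :=
      (b.coord i).continuous_of_finiteDimensional
    obtain ⟨k, hk, h⟩ := hK.exists_isMinOn hK' hcont.continuousOn
    exact ⟨k, hk, fun x hx => h hx⟩
  choose k hk hkmin using hmin
  have hR : circumradius K C ≤ d := by
    refine circumradius_le hd0 (t := d • p - ∑ i, b.repr (k i) i • b i) fun x hx => ?_
    rw [hCv]
    have hdiv : ∀ i, d * ((b.repr x i - b.repr (k i) i) / d) = b.repr x i - b.repr (k i) i := by
      intro i
      rcases hd0.eq_or_lt with h0 | h0
      · have h1 := hcoord i x hx (k i) (hk i)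
        have h2 := hkmin i x hx
        rw [← h0] at h1 ⊢
        linarith
      · exact mul_div_cancel₀ _ h0.ne'
    refine ⟨p + ∑ i, ((b.repr x i - b.repr (k i) i) / d) • b i, ⟨_, fun i => ?_, rfl⟩, ?_⟩
    · have hrepr : b.repr (∑ j, ((b.repr x j - b.repr (k j) j) / d) • b j) i =
          (b.repr x i - b.repr (k i) i) / d := by
        rw [b.repr_sum_self]
      rw [hrepr]
      have h1 := hcoord i x hx (k i) (hk i)
      have h2 := hkmin i x hx
      exact ⟨div_nonneg (sub_nonneg.2 h2) hd0, div_le_one_of_le₀ h1 hd0⟩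
    · simp only [smul_add, Finset.smul_sum, smul_smul, hdiv, sub_smul, Finset.sum_sub_distrib]
      rw [b.sum_repr]
      abel
  linarith

section SmoothNormals

variable {E : Type*} [NormedAddCommGroup E] [NormedSpace ℝ E]

/-- The linear functionals that are the only supporting functional of `C`, normalised to have
maximum one on `C`, at some boundary point. -/
def smoothNormals (C : Set E) : Set (Module.Dual ℝ E) :=
  {a | ∃ p, gauge C p = 1 ∧ a p = 1 ∧ (∀ y, a y ≤ gauge C y) ∧
    ∀ b : Module.Dual ℝ E, (∀ y, b y ≤ gauge C y) → b p = 1 → b = a}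

theorem ne_zero_of_mem_smoothNormals {C : Set E} {a : Module.Dual ℝ E}
    (ha : a ∈ smoothNormals C) : a ≠ 0 := by
  obtain ⟨p, -, hp, -⟩ := ha
  rintro rfl
  simp at hp

theorem neg_mem_smoothNormals {C : Set E} (hsymm : ∀ x ∈ C, -x ∈ C) {a : Module.Dual ℝ E}
    (ha : a ∈ smoothNormals C) : -a ∈ smoothNormals C := by
  obtain ⟨p, hp, hap, hle, huniq⟩ := ha
  refine ⟨-p, by rwa [gauge_neg hsymm], by simpa using hap, fun y => ?_, fun b hb hbp => ?_⟩
  · simpa [gauge_neg hsymm] using hle (-y)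
  · rw [← huniq (-b) (fun y => by simpa [gauge_neg hsymm] using hb (-y)) (by simpa using hbp),
      neg_neg]

/-- At a point of differentiability of the gauge, the derivative is the only supporting
functional. -/
theorem fderiv_mem_smoothNormals [FiniteDimensional ℝ E] {C : Set E} (hconv : Convex ℝ C)
    (h0 : C ∈ nhds (0 : E)) {x : E} (hx : 0 < gauge C x) {a : StrongDual ℝ E}
    (ha : HasFDerivAt (gauge C) a x) :
    (a : Module.Dual ℝ E) ∈ smoothNormals C ∧ a x = gauge C x := by
  have habs := absorbent_nhds_zero (𝕜 := ℝ) h0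
  have hline : ∀ y, Filter.Tendsto (fun t : ℝ => t⁻¹ • (gauge C (x + t • y) - gauge C x))
      (nhdsWithin 0 (Ioi 0)) (nhds (a y)) := by
    intro y
    have h1 : HasDerivAt (fun t : ℝ => x + t • y) y 0 := by
      simpa using ((hasDerivAt_id (0 : ℝ)).smul_const y).const_add x
    have h2 : HasFDerivAt (gauge C) a (x + (0 : ℝ) • y) := by simpa using ha
    have h3 := (h2.comp_hasDerivAt (0 : ℝ) h1).tendsto_slope_zero_right
    simpa using h3
  have hle : ∀ y, a y ≤ gauge C y := by
    intro y
    refine le_of_tendsto (hline y) (eventually_nhdsWithin_of_forall fun t (ht : 0 < t) => ?_)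
    have h1 := gauge_add_le hconv habs x (t • y)
    rw [gauge_smul_of_nonneg ht.le, smul_eq_mul] at h1
    rw [smul_eq_mul, inv_mul_le_iff₀ ht]
    linarith
  have heq : a x = gauge C x := by
    refine tendsto_nhds_unique (hline x) (tendsto_const_nhds.congr' ?_)
    refine eventually_nhdsWithin_of_forall fun t (ht : 0 < t) => ?_
    have h1 : x + t • x = (1 + t) • x := by rw [add_smul, one_smul]
    change gauge C x = t⁻¹ • (gauge C (x + t • x) - gauge C x)
    rw [h1, gauge_smul_of_nonneg (by positivity), smul_eq_mul, smul_eq_mul]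
    field_simp
    ring
  refine ⟨⟨(gauge C x)⁻¹ • x, ?_, ?_, hle, fun b hb hbp => ?_⟩, heq⟩
  · rw [gauge_smul_of_nonneg (inv_nonneg.2 hx.le), smul_eq_mul, inv_mul_cancel₀ hx.ne']
  · change a _ = 1
    rw [map_smul, heq, smul_eq_mul, inv_mul_cancel₀ hx.ne']
  · have hbx : b x = gauge C x := by
      rw [map_smul, smul_eq_mul, inv_mul_eq_one₀ hx.ne'] at hbp
      exact hbp.symm
    let b' : StrongDual ℝ E := LinearMap.toContinuousLinearMap b
    have hmax : IsLocalMax (fun y => b' y - gauge C y) x := by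
      refine Filter.Eventually.of_forall fun y => ?_
      change b y - gauge C y ≤ b x - gauge C x
      linarith [hb y]
    have hz := hmax.hasFDerivAt_eq_zero (b'.hasFDerivAt.sub ha)
    ext y
    have := DFunLike.congr_fun hz y
    change b y - a y = 0 at this
    change b y = a y
    linarith

theorem dense_setOf_exists_smoothNormal [FiniteDimensional ℝ E] [Nontrivial E] {C : Set E}
    (hc : IsCompact C) (hconv : Convex ℝ C) (h0 : C ∈ nhds (0 : E)) :
    Dense {y : E | ∃ a ∈ smoothNormals C, a y = gauge C y} := by
  borelize E
  let μ : MeasureTheory.Measure E := MeasureTheory.Measure.addHaar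
  obtain ⟨L, hL⟩ := hconv.lipschitz_gauge h0
  have h1 : ∀ᵐ x ∂μ, DifferentiableAt ℝ (gauge C) x := hL.ae_differentiableAt
  have h2 : ∀ᵐ x ∂μ, x ≠ 0 := by
    simp [MeasureTheory.ae_iff]
  refine MeasureTheory.Measure.dense_of_ae (μ := μ) ?_
  filter_upwards [h1, h2] with x hx hx0
  have hpos := (gauge_pos (absorbent_nhds_zero h0) (hc.isVonNBounded ℝ)).2 hx0
  have := fderiv_mem_smoothNormals hconv h0 hpos hx.hasFDerivAt
  exact ⟨_, this.1, this.2⟩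

/-- The gauge is the supremum of the smooth normals. -/
theorem gauge_le_of_forall_smoothNormals [FiniteDimensional ℝ E] [Nontrivial E] {C : Set E}
    (hc : IsCompact C) (hconv : Convex ℝ C) (h0 : C ∈ nhds (0 : E)) {y : E} {r : ℝ}
    (h : ∀ a ∈ smoothNormals C, a y ≤ r) : gauge C y ≤ r := by
  have hg := continuous_gauge hconv h0
  have hclosed : IsClosed {z : E | gauge C y ≤ r + gauge C (z - y) + gauge C (y - z)} :=
    isClosed_le continuous_const (by fun_prop)
  have hsub : {z : E | ∃ a ∈ smoothNormals C, a z = gauge C z} ⊆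
      {z : E | gauge C y ≤ r + gauge C (z - y) + gauge C (y - z)} := by
    rintro z ⟨a, ha, haz⟩
    have h1 := gauge_add_le hconv (absorbent_nhds_zero h0) z (y - z)
    rw [add_sub_cancel] at h1
    have h2 : a (z - y) ≤ gauge C (z - y) := by
      obtain ⟨p, -, -, hle, -⟩ := ha
      exact hle _
    rw [map_sub] at h2
    have h3 := h a ha
    change gauge C y ≤ r + gauge C (z - y) + gauge C (y - z)
    linarith
  have := hclosed.closure_subset_iff.2 hsub
    (dense_setOf_exists_smoothNormal hc hconv h0 y)
  simpa using this

theorem exists_dual_eq_gauge {C : Set E} (hconv : Convex ℝ C) (h0 : C ∈ nhds (0 : E)) {w : E}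
    (hw : w ≠ 0) : ∃ b : Module.Dual ℝ E, b w = gauge C w ∧ ∀ y, b y ≤ gauge C y := by
  let f : E →ₗ.[ℝ] ℝ := LinearPMap.mkSpanSingleton w (gauge C w) hw
  obtain ⟨b, hb, hle⟩ := exists_extension_of_le_sublinear f (gauge C)
    (fun c hc x => by rw [gauge_smul_of_nonneg hc.le, smul_eq_mul])
    (gauge_add_le hconv (absorbent_nhds_zero h0)) (by
      rintro ⟨x, hx⟩
      obtain ⟨c, rfl⟩ := Submodule.mem_span_singleton.1 hx
      rw [LinearPMap.mkSpanSingleton'_apply, RingHom.id_apply, smul_eq_mul]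
      rcases le_total 0 c with h | h
      · rw [gauge_smul_of_nonneg h, smul_eq_mul]
      · exact (mul_nonpos_of_nonpos_of_nonneg h (gauge_nonneg _)).trans (gauge_nonneg _))
  refine ⟨b, ?_, hle⟩
  have := hb ⟨w, Submodule.mem_span_singleton_self w⟩
  rw [this]
  exact LinearPMap.mkSpanSingleton_apply ..

/-- If two points of a symmetric body are at maximal distance, then the unique supporting
functionals at these points are opposite. -/
theorem eq_neg_of_two_le_gauge_sub {C : Set E} (hconv : Convex ℝ C) (h0 : C ∈ nhds (0 : E))
    (hsymm : ∀ x ∈ C, -x ∈ C) {a a' : Module.Dual ℝ E} {p p' : E}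
    (hp : gauge C p = 1) (hp' : gauge C p' = 1)
    (ha : ∀ b : Module.Dual ℝ E, (∀ y, b y ≤ gauge C y) → b p = 1 → b = a)
    (ha' : ∀ b : Module.Dual ℝ E, (∀ y, b y ≤ gauge C y) → b p' = 1 → b = a')
    (h : 2 ≤ gauge C (p - p')) : a' = -a := by
  have hw : p - p' ≠ 0 := by
    intro hw
    rw [hw, gauge_zero] at h
    linarith
  obtain ⟨b, hb, hle⟩ := exists_dual_eq_gauge hconv h0 hw
  have h1 := hle p
  have h2 := hle (-p')
  rw [gauge_neg hsymm, hp'] at h2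
  rw [hp] at h1
  rw [map_sub] at hb
  rw [map_neg] at h2
  rw [← ha b hle (by linarith), ← ha' (-b) (fun y => ?_) (by rw [LinearMap.neg_apply]; linarith)]
  have := hle (-y)
  rwa [gauge_neg hsymm, map_neg] at this

/-- For a symmetric gauge body, circumradii of pairs are half the distance. -/
theorem circumradius_pair_le_of_gauge_sub_le {C : Set E} (hc : IsCompact C) (hconv : Convex ℝ C)
    (h0 : (0 : E) ∈ interior C) (hsymm : ∀ x ∈ C, -x ∈ C) {x y : E} {d : ℝ}
    (h : gauge C (x - y) ≤ 2 * d) : circumradius {x, y} C ≤ d := by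
  have hd : 0 ≤ d := by linarith [gauge_nonneg (s := C) (x - y)]
  have key : gauge C ((2⁻¹ : ℝ) • (x - y)) ≤ d := by
    rw [gauge_smul_of_nonneg (by norm_num), smul_eq_mul]
    linarith
  refine circumradius_le hd (t := -((2⁻¹ : ℝ) • (x + y))) ?_
  rintro k (rfl | rfl)
  · rw [mem_smul_iff_gauge_le hc hconv h0 hd]
    convert key using 2
    module
  · rw [mem_smul_iff_gauge_le hc hconv h0 hd, ← gauge_neg hsymm]
    convert key using 2
    module

/-- If all diameters are twice the circumradii, a positively dependent family of smooth normals
contains an opposite pair. -/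
theorem exists_eq_neg_of_sum_smul_eq_zero {C : Set E} (hc : IsCompact C) (hconv : Convex ℝ C)
    (h0 : (0 : E) ∈ interior C) (hsymm : ∀ x ∈ C, -x ∈ C)
    (H : ∀ K : Set E, IsCompact K → Convex ℝ K → K.Nonempty →
      gaugeDiameter K C = 2 * circumradius K C)
    {ι : Type*} [Fintype ι] {a : ι → Module.Dual ℝ E} (ha : ∀ i, a i ∈ smoothNormals C)
    {w : ι → ℝ} (hw : ∀ i, 0 ≤ w i) (hpos : 0 < ∑ i, w i) (hsum : ∑ i, w i • a i = 0) :
    ∃ i j, a j = -a i := by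
  have hnhds : C ∈ nhds (0 : E) := mem_interior_iff_mem_nhds.1 h0
  choose p hp hap hle huniq using ha
  have hne : Nonempty ι := by
    by_contra hemp
    rw [not_nonempty_iff] at hemp
    simp at hpos
  suffices h : ∃ i j, 2 ≤ gauge C (p i - p j) by
    obtain ⟨i, j, hij⟩ := h
    exact ⟨i, j, eq_neg_of_two_le_gauge_sub hconv hnhds hsymm (hp i) (hp j) (huniq i) (huniq j) hij⟩
  by_contra! hlt
  obtain ⟨⟨i₀, j₀⟩, hmax⟩ := Finite.exists_max fun q : ι × ι => gauge C (p q.1 - p q.2)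
  set d := gauge C (p i₀ - p j₀) / 2 with hd
  have hd1 : d < 1 := by linarith [hlt i₀ j₀]
  let K : Set E := convexHull ℝ (range p)
  have hKc : IsCompact K := (finite_range p).isCompact_convexHull ℝ
  have hK' : K.Nonempty := (range_nonempty p).convexHull
  have hpK : ∀ i, p i ∈ K := fun i => subset_convexHull ℝ _ (mem_range_self i)
  have hR : 1 ≤ circumradius K C := by
    obtain ⟨t, ht⟩ := exists_forall_add_mem_circumradius_smul hKc hK' hc hconv ⟨0, h0⟩
    set R := circumradius K C
    have hi : ∀ i, a i t + 1 ≤ R := fun i => by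
      have h1 := gauge_le_of_mem (circumradius_nonneg K C) (ht _ (hpK i))
      have h2 := hle i (t + p i)
      rw [map_add, hap i] at h2
      exact h2.trans h1
    have hs : ∑ i, w i * (a i t + 1) ≤ ∑ i, w i * R :=
      Finset.sum_le_sum fun i _ => mul_le_mul_of_nonneg_left (hi i) (hw i)
    have hz : ∑ i, w i * a i t = 0 := by
      have := DFunLike.congr_fun hsum t
      simpa using this
    simp only [mul_add, mul_one, Finset.sum_add_distrib, hz, zero_add, ← Finset.sum_mul] at hs
    exact le_of_mul_le_mul_left (by simpa using hs) hpos
  have hD : gaugeDiameter K C ≤ 2 * d := by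
    refine gaugeDiameter_le hK' fun x hx y hy => ?_
    refine circumradius_pair_le_of_gauge_sub_le hc hconv h0 hsymm ?_
    have hsub : K - K ⊆ {z | gauge C z ≤ 2 * d} := by
      rw [← convexHull_sub]
      refine convexHull_min ?_
        (hconv.setOfPred_gauge_le (interior_subset h0) (absorbent_nhds_zero hnhds) _)
      rintro _ ⟨_, ⟨i, rfl⟩, _, ⟨j, rfl⟩, rfl⟩
      have := hmax (i, j)
      change gauge C (p i - p j) ≤ 2 * d
      simp only at this
      linarith
    exact hsub (sub_mem_sub hx hy)
  have := H K hKc (convex_convexHull ℝ _) hK'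
  linarith

end SmoothNormals

section Converse

variable {E : Type*} [NormedAddCommGroup E] [NormedSpace ℝ E]

/-- If all diameters are twice the circumradii, the gauge body has a centre of symmetry. -/
theorem exists_symmetric_vadd {C : Set E} (hc : IsCompact C) (hconv : Convex ℝ C)
    (hint : (interior C).Nonempty)
    (H : ∀ K : Set E, IsCompact K → Convex ℝ K → K.Nonempty →
      gaugeDiameter K C = 2 * circumradius K C) :
    ∃ c : E, ∀ x ∈ c +ᵥ C, -x ∈ c +ᵥ C := by
  have hne : (-C).Nonempty := (hint.mono interior_subset).neg
  have hD : gaugeDiameter (-C) C ≤ 2 * 1 := by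
    refine gaugeDiameter_le hne fun x hx y hy => ?_
    refine circumradius_le zero_le_one (t := -x - y) ?_
    rw [one_smul]
    rintro k (rfl | rfl)
    · simpa [sub_add_eq_add_sub] using hy
    · simpa using hx
  have hR : circumradius (-C) C ≤ 1 := by
    have := H (-C) hc.neg hconv.neg hne
    linarith
  have hR0 : 0 ≤ circumradius (-C) C := circumradius_nonneg _ _
  obtain ⟨c, h0⟩ := exists_zero_mem_interior_vadd hint
  obtain ⟨t, ht⟩ : ∃ t : E, ∀ k ∈ -C, t + k ∈ C := by
    obtain ⟨t, ht⟩ := exists_forall_add_mem_circumradius_smul hc.neg hne (hc.vadd c)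
      (hconv.vadd c) ⟨0, h0⟩
    rw [circumradius_vadd_right] at ht
    refine ⟨-c + t, fun k hk => ?_⟩
    have h1 : t + k ∈ (1 : ℝ) • (c +ᵥ C) := by
      rw [mem_smul_iff_gauge_le (hc.vadd c) (hconv.vadd c) h0 zero_le_one]
      exact (gauge_le_of_mem hR0 (ht k hk)).trans hR
    rw [one_smul] at h1
    obtain ⟨x, hx, hxt⟩ := h1
    have : -c + t + k = x := by
      rw [add_assoc, ← hxt]
      simp
    rwa [this]
  refine ⟨-((2⁻¹ : ℝ) • t), ?_⟩
  rintro _ ⟨x, hx, rfl⟩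
  refine ⟨t + -x, ht _ (by simpa using hx), ?_⟩
  simp only [vadd_eq_add]
  module

theorem zero_mem_interior_of_symmetric {C : Set E} (hconv : Convex ℝ C)
    (hint : (interior C).Nonempty) (hsymm : ∀ x ∈ C, -x ∈ C) : (0 : E) ∈ interior C := by
  have hneg : -C = C := by
    ext x
    exact ⟨fun h => by simpa using hsymm _ h, fun h => hsymm x h⟩
  obtain ⟨x, hx⟩ := hint
  have hx' : -x ∈ interior C := by
    have : Homeomorph.neg E ⁻¹' interior C = interior (-C) :=
      (Homeomorph.neg E).preimage_interior C
    rw [hneg] at this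
    exact this.ge hx
  have := hconv.interior hx hx' (a := 2⁻¹) (b := 2⁻¹) (by norm_num) (by norm_num) (by norm_num)
  simpa using this

/-- The smooth normals are, up to sign, the members of any basis selected from them. -/
theorem mem_or_neg_mem_of_mem_smoothNormals [FiniteDimensional ℝ E] {C : Set E}
    (hc : IsCompact C) (hconv : Convex ℝ C)
    (h0 : (0 : E) ∈ interior C) (hsymm : ∀ x ∈ C, -x ∈ C)
    (H : ∀ K : Set E, IsCompact K → Convex ℝ K → K.Nonempty →
      gaugeDiameter K C = 2 * circumradius K C)
    {B : Set (Module.Dual ℝ E)} (hB : B ⊆ smoothNormals C)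
    (hli : LinearIndependent ℝ ((↑) : B → Module.Dual ℝ E)) {a : Module.Dual ℝ E}
    (ha : a ∈ smoothNormals C) (hspan : a ∈ Submodule.span ℝ B) : a ∈ B ∨ -a ∈ B := by
  have hfin : Finite B := hli.finite
  have := Fintype.ofFinite B
  have hspan' : a ∈ Submodule.span ℝ (range ((↑) : B → Module.Dual ℝ E)) := by
    rwa [Subtype.range_coe]
  obtain ⟨c, hca⟩ := (Submodule.mem_span_range_iff_exists_fun ℝ).1 hspan'
  let σ : B → ℝ := fun e => if 0 ≤ c e then -1 else 1
  have hσ : ∀ e, σ e = 1 ∨ σ e = -1 := fun e => by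
    by_cases h : 0 ≤ c e <;> simp [σ, h]
  have hneg : ∀ e : B, (-1 : ℝ) • (e : Module.Dual ℝ E) = -(e : Module.Dual ℝ E) := fun e => by
    ext x
    simp
  let u : Option B → Module.Dual ℝ E := fun o => o.elim a fun e => σ e • (e : Module.Dual ℝ E)
  let w : Option B → ℝ := fun o => o.elim 1 fun e => |c e|
  have hu : ∀ o, u o ∈ smoothNormals C := by
    rintro (_ | e)
    · exact ha
    · change σ e • (e : Module.Dual ℝ E) ∈ smoothNormals C
      rcases hσ e with h | h
      · rw [h, one_smul]
        exact hB e.2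
      · rw [h, hneg]
        exact neg_mem_smoothNormals hsymm (hB e.2)
  have hw : ∀ o, 0 ≤ w o := by
    rintro (_ | e)
    · exact zero_le_one
    · exact abs_nonneg _
  have hpos : 0 < ∑ o, w o :=
    lt_of_lt_of_le one_pos (Finset.single_le_sum (f := w) (fun o _ => hw o) (Finset.mem_univ none))
  have hsum : ∑ o, w o • u o = 0 := by
    rw [Fintype.sum_option]
    change (1 : ℝ) • a + ∑ e, |c e| • σ e • (e : Module.Dual ℝ E) = 0
    rw [one_smul, ← hca, ← Finset.sum_add_distrib]
    refine Finset.sum_eq_zero fun e _ => ?_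
    have hce : |c e| * σ e = -c e := by
      by_cases h : 0 ≤ c e
      · simp [σ, h, abs_of_nonneg h]
      · simp [σ, h, abs_of_neg (not_le.1 h)]
    rw [smul_smul, hce, neg_smul, add_neg_cancel]
  obtain ⟨i, j, hij⟩ :=
    exists_eq_neg_of_sum_smul_eq_zero hc hconv h0 hsymm H hu hw hpos hsum
  have hself : ∀ i, u i ≠ -u i := fun i h => by
    rw [eq_neg_iff_add_eq_zero, ← two_smul ℝ] at h
    exact ne_zero_of_mem_smoothNormals (hu i) ((smul_eq_zero.1 h).resolve_left two_ne_zero)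
  have hmem : ∀ e : B, a = -(σ e • (e : Module.Dual ℝ E)) → a ∈ B ∨ -a ∈ B := by
    rintro e he
    rcases hσ e with h | h
    · right
      rw [he, h, one_smul, neg_neg]
      exact e.2
    · left
      rw [he, h, hneg, neg_neg]
      exact e.2
  rcases i with _ | e <;> rcases j with _ | e'
  · exact absurd hij (hself none)
  · exact hmem e' (neg_eq_iff_eq_neg.1 hij.symm)
  · exact hmem e hij
  · by_cases hee : e' = e
    · rw [hee] at hij
      exact absurd hij (hself _)
    · exfalso
      have hz : σ e' • (e' : Module.Dual ℝ E) + σ e • (e : Module.Dual ℝ E) = 0 :=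
        eq_neg_iff_add_eq_zero.1 hij
      have := (LinearIndepOn.pair_iff _ hee).1 (hli.linearIndepOn _) _ _ hz
      rcases hσ e with h | h <;> simp [h] at this

/-- A bounded body cut out by `|e x| ≤ 1`, for linearly independent `e`, is a parallelotope. -/
theorem isParallelotope_of_forall_abs_le {n : ℕ} {C : Set (EuclideanSpace ℝ (Fin n))}
    (hc : IsCompact C) {B : Set (Module.Dual ℝ (EuclideanSpace ℝ (Fin n)))}
    (hli : LinearIndependent ℝ ((↑) : B → Module.Dual ℝ (EuclideanSpace ℝ (Fin n))))
    (hCB : ∀ x, x ∈ C ↔ ∀ e ∈ B, |e x| ≤ 1) : IsParallelotope C := by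
  have hfin : Finite B := hli.finite
  have := Fintype.ofFinite B
  have hker : ∀ x, (∀ e ∈ B, e x = 0) → x = 0 := by
    intro x hx
    by_contra hx0
    obtain ⟨M, hM⟩ := hc.isBounded.exists_norm_le
    have hmem : ((M + 1) / ‖x‖) • x ∈ C := (hCB _).2 fun e he => by simp [hx e he]
    have h1 := hM _ hmem
    have hxn : 0 < ‖x‖ := norm_pos_iff.2 hx0
    rw [norm_smul, norm_div, norm_norm, div_mul_cancel₀ _ hxn.ne', Real.norm_eq_abs] at h1
    linarith [le_abs_self (M + 1)]
  let φ₀ : EuclideanSpace ℝ (Fin n) →ₗ[ℝ] (B → ℝ) := LinearMap.pi fun e => (e : Module.Dual ℝ _)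
  have hinj : Function.Injective φ₀ := by
    rw [injective_iff_map_eq_zero]
    intro x hx
    exact hker x fun e he => congrFun hx ⟨e, he⟩
  have hcard : Fintype.card B = n := by
    refine le_antisymm ?_ ?_
    · have := hli.fintype_card_le_finrank
      rwa [Subspace.dual_finrank_eq, finrank_euclideanSpace_fin] at this
    · have := LinearMap.finrank_le_finrank_of_injective hinj
      rwa [finrank_euclideanSpace_fin, Module.finrank_fintype_fun_eq_card] at this
  let ε : Fin n ≃ B := (Fintype.equivFinOfCardEq hcard).symm
  let φ₁ : EuclideanSpace ℝ (Fin n) ≃ₗ[ℝ] (B → ℝ) :=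
    φ₀.linearEquivOfInjective hinj (by simp [hcard])
  let φ : EuclideanSpace ℝ (Fin n) ≃ₗ[ℝ] (Fin n → ℝ) :=
    φ₁.trans (LinearEquiv.funCongrLeft ℝ ℝ ε)
  have hφ : ∀ x i, φ x i = (ε i : Module.Dual ℝ _) x := fun x i => rfl
  have hCφ : ∀ x, x ∈ C ↔ ∀ i, |φ x i| ≤ 1 := by
    intro x
    rw [hCB]
    refine ⟨fun h i => h _ (ε i).2, fun h e he => ?_⟩
    have := h (ε.symm ⟨e, he⟩)
    rwa [hφ, Equiv.apply_symm_apply] at this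
  let b : Module.Basis (Fin n) ℝ (EuclideanSpace ℝ (Fin n)) := Module.Basis.ofEquivFun φ
  have hφb : ∀ (s : Fin n → ℝ), φ (∑ i, s i • (2 : ℝ) • b i) = fun i => s i * 2 := by
    intro s
    have : ∑ i, s i • (2 : ℝ) • b i = ∑ i, (s i * 2) • b i := by simp only [smul_smul]
    rw [this, ← b.equivFun_symm_apply]
    simp [b]
  let p : EuclideanSpace ℝ (Fin n) := φ.symm fun _ => -1
  have hp : ∀ i, φ p i = -1 := fun i => by simp [p]
  refine ⟨p, fun i => (2 : ℝ) • b i, ?_, ?_⟩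
  · exact b.linearIndependent.units_smul fun _ => Units.mk0 (2 : ℝ) two_ne_zero
  · ext x
    rw [hCφ]
    simp only [mem_vadd_set, mem_parallelepiped_iff]
    constructor
    · intro h
      refine ⟨x - p, ⟨fun i => (φ x i + 1) / 2, ⟨fun i => ?_, fun i => ?_⟩, ?_⟩, by simp⟩
      · have := (abs_le.1 (h i)).1
        simp only [Pi.zero_apply]
        linarith
      · have := (abs_le.1 (h i)).2
        simp only [Pi.one_apply]
        linarith
      · apply φ.injective
        rw [hφb, map_sub]
        funext i
        rw [Pi.sub_apply, hp]
        ring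
    · rintro ⟨_, ⟨s, ⟨hs0, hs1⟩, rfl⟩, rfl⟩ i
      have h0 := hs0 i
      have h1 := hs1 i
      rw [vadd_eq_add, map_add, hφb, Pi.add_apply, hp, abs_le]
      simp only [Pi.zero_apply, Pi.one_apply] at h0 h1
      constructor <;> linarith

theorem isParallelotope_of_symmetric {n : ℕ} {C : Set (EuclideanSpace ℝ (Fin n))}
    (hc : IsCompact C) (hconv : Convex ℝ C) (h0 : 0 ∈ interior C) (hsymm : ∀ x ∈ C, -x ∈ C)
    (H : ∀ K : Set (EuclideanSpace ℝ (Fin n)), IsCompact K → Convex ℝ K → K.Nonempty →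
      gaugeDiameter K C = 2 * circumradius K C) : IsParallelotope C := by
  obtain ⟨B, hB, hspan, hli⟩ := exists_linearIndependent ℝ (smoothNormals C)
  refine isParallelotope_of_forall_abs_le hc hli fun x => ?_
  have hone : ∀ y, y ∈ C ↔ gauge C y ≤ 1 := fun y => by
    simpa using mem_smul_iff_gauge_le hc hconv h0 zero_le_one (x := y)
  constructor
  · intro hx e he
    obtain ⟨p, -, -, hle, -⟩ := hB he
    refine abs_le.2 ⟨?_, (hle x).trans ((hone x).1 hx)⟩
    have := (hle (-x)).trans ((hone _).1 (hsymm x hx))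
    rw [map_neg] at this
    linarith
  · intro h
    rcases subsingleton_or_nontrivial (EuclideanSpace ℝ (Fin n)) with hs | hs
    · rw [Subsingleton.elim x 0]
      exact interior_subset h0
    refine (hone x).2 (gauge_le_of_forall_smoothNormals hc hconv
      (mem_interior_iff_mem_nhds.1 h0) fun a ha => ?_)
    have ha' : a ∈ Submodule.span ℝ B := hspan ▸ Submodule.subset_span ha
    rcases mem_or_neg_mem_of_mem_smoothNormals hc hconv h0 hsymm H hB hli ha ha' with h1 | h1
    · exact (abs_le.1 (h a h1)).2
    · have := (abs_le.1 (h _ h1)).1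
      rw [LinearMap.neg_apply] at this
      linarith

theorem IsParallelotope.vadd {n : ℕ} {C : Set (EuclideanSpace ℝ (Fin n))}
    (h : IsParallelotope C) (c : EuclideanSpace ℝ (Fin n)) : IsParallelotope (c +ᵥ C) := by
  obtain ⟨p, v, hv, rfl⟩ := h
  exact ⟨c + p, v, hv, by rw [vadd_vadd]⟩

/-- A gauge body for which all diameters are twice the circumradii is a parallelotope. -/
theorem isParallelotope_of_gaugeDiameter_eq {n : ℕ} {C : Set (EuclideanSpace ℝ (Fin n))}
    (hc : IsCompact C) (hconv : Convex ℝ C) (hint : (interior C).Nonempty)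
    (H : ∀ K : Set (EuclideanSpace ℝ (Fin n)), IsCompact K → Convex ℝ K → K.Nonempty →
      gaugeDiameter K C = 2 * circumradius K C) : IsParallelotope C := by
  obtain ⟨c, hsymm⟩ := exists_symmetric_vadd hc hconv hint H
  have hint' : (interior (c +ᵥ C)).Nonempty := by
    rw [interior_vadd]
    exact hint.vadd_set
  have := isParallelotope_of_symmetric (hc.vadd c) (hconv.vadd c)
    (zero_mem_interior_of_symmetric (hconv.vadd c) hint' hsymm) hsymm (fun K h1 h2 h3 => by
      rw [gaugeDiameter_vadd_right, circumradius_vadd_right, H K h1 h2 h3])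
  simpa using this.vadd (-c)

end Converse

theorem mem_convexHull_zero_one_one_one_iff {p : ℝ × ℝ} :
    p ∈ convexHull ℝ {((0 : ℝ), (1 : ℝ)), ((1 : ℝ), (1 : ℝ))} ↔ p.1 ∈ Icc (0 : ℝ) 1 ∧ p.2 = 1 := by
  rw [convexHull_pair, segment_eq_image]
  constructor
  · rintro ⟨θ, hθ, rfl⟩
    simpa using hθ
  · rintro ⟨h1, h2⟩
    exact ⟨p.1, h1, Prod.ext (by simp) (by simp [h2])⟩

theorem theorem1p5 {n : ℕ} (C : ConvexBody (EuclideanSpace ℝ (Fin n)))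
    (hC : (interior (C : Set (EuclideanSpace ℝ (Fin n)))).Nonempty) :
    (2 ≤ n →
      convexHull ℝ {((0 : ℝ), (1 : ℝ)), ((1 : ℝ), (1 : ℝ))} ⊆ diagram C ∧
      (convexHull ℝ {((0 : ℝ), (1 : ℝ)), ((1 : ℝ), (1 : ℝ))} = diagram C ↔
        IsParallelotope (C : Set (EuclideanSpace ℝ (Fin n))))) ∧
    (IsParallelotope (C : Set (EuclideanSpace ℝ (Fin n))) ↔
      ∀ K : ConvexBody (EuclideanSpace ℝ (Fin n)),
        gaugeDiameter (K : Set (EuclideanSpace ℝ (Fin n))) C =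
          2 * circumradius (K : Set (EuclideanSpace ℝ (Fin n))) C) := by
  have hc := C.isCompact
  have hconv := C.convex
  have hiff : IsParallelotope (C : Set (EuclideanSpace ℝ (Fin n))) ↔
      ∀ K : ConvexBody (EuclideanSpace ℝ (Fin n)),
        gaugeDiameter (K : Set (EuclideanSpace ℝ (Fin n))) C =
          2 * circumradius (K : Set (EuclideanSpace ℝ (Fin n))) C :=
    ⟨fun h K => h.gaugeDiameter_eq hc hconv hC K.isCompact K.nonempty,
      fun H => isParallelotope_of_gaugeDiameter_eq hc hconv hC
        fun K h1 h2 h3 => H ⟨K, h2, h1, h3⟩⟩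
  refine ⟨fun hn => ?_, hiff⟩
  have : Nontrivial (EuclideanSpace ℝ (Fin n)) :=
    Module.nontrivial_of_finrank_pos (R := ℝ) (by rw [finrank_euclideanSpace_fin]; lia)
  have hsub : convexHull ℝ {((0 : ℝ), (1 : ℝ)), ((1 : ℝ), (1 : ℝ))} ⊆ diagram C := by
    intro p hp
    rw [mem_convexHull_zero_one_one_one_iff] at hp
    obtain ⟨K, h1, h2, h3, hr, hR, hD⟩ :=
      exists_inradius_eq (by rwa [finrank_euclideanSpace_fin]) hc hconv hC hp.1
    refine ⟨⟨K, h2, h1, h3.nonempty⟩, h3, ?_⟩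
    change p = diagramPoint K C
    rw [diagramPoint, hr, hR, hD]
    exact Prod.ext (by simp) (by simp [hp.2])
  refine ⟨hsub, fun heq => hiff.2 fun K => ?_, fun hpar => hsub.antisymm ?_⟩
  · rcases (K : Set (EuclideanSpace ℝ (Fin n))).subsingleton_or_nontrivial with hs | hs
    · obtain ⟨x, hx⟩ := K.nonempty
      have hKx : (K : Set (EuclideanSpace ℝ (Fin n))) = {x} := hs.eq_singleton_of_mem hx
      simp [hKx, gaugeDiameter]
    · have hmem : diagramPoint (K : Set (EuclideanSpace ℝ (Fin n))) C ∈ diagram C := ⟨K, hs, rfl⟩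
      rw [← heq, mem_convexHull_zero_one_one_one_iff] at hmem
      have hpos := circumradius_pos K.isCompact hs hc hconv hC
      exact (div_eq_one_iff_eq (by positivity)).1 hmem.2
  · rintro _ ⟨K, hK, rfl⟩
    have hpos := circumradius_pos K.isCompact hK hc hconv hC
    rw [mem_convexHull_zero_one_one_one_iff]
    refine ⟨⟨div_nonneg (inradius_nonneg _ _) hpos.le, div_le_one_of_le₀
      (inradius_le_circumradius K.isCompact K.nonempty hc hconv hC) hpos.le⟩, ?_⟩
    exact (div_eq_one_iff_eq (by positivity)).2 (hiff.1 hpar K)
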